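/- Let $G$ be a group, let $g,h\in G$, and suppose that $G$ has a $(g,h)$-wS-subset, i.e. a subset $E\subseteq G$ for which there exist elements $a\neq b$ of $E$ with $gE=E\smallsetminus\{a\}$ and $hE=E\smallsetminus\{b\}$. Let $H=\langle g,h\rangle$ be the subgroup generated by $g$ and $h$. Then either $H$ is free over the pair $(g,h)$ (that is, the homomorphism from the free group on two generators $x,y$ to $H$ with $x\mapsto g$, $y\mapsto h$ is an isomorphism), or there exists an integer $k\ge 2$ such that $H$ has the presentation $G_k=\langle g,h\mid (h^{-1}g)^k\rangle$ (that is, $x\mapsto g$, $y\mapsto h$ induces an isomorphism from $\langle x,y\mid (y^{-1}x)^k\rangle$ onto $H$). -/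

import Mathlib

open scoped Pointwise

/-- `E` is a `(g, h)`-wS-subset (weak Sierpiński subset with respect to `g` and `h`) of `G`:
there are `a ≠ b` in `E` with `gE = E \ {a}` and `hE = E \ {b}`. -/
def IsWSSubset {G : Type*} [Group G] (g h : G) (E : Set G) : Prop :=
  ∃ a ∈ E, ∃ b ∈ E, a ≠ b ∧ g • E = E \ {a} ∧ h • E = E \ {b}

/-- The subgroup generated by `g` and `h` has the presentation `⟨x₀, x₁ | rels⟩`, with the
generator `x₀` corresponding to `g` and the generator `x₁` to `h`. -/
def PairHasPresentation {G : Type*} [Group G] (g h : G) (rels : Set (FreeGroup (Fin 2))) : Prop :=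
  ∃ e : PresentedGroup rels ≃* Subgroup.closure ({g, h} : Set G),
    (e (PresentedGroup.of 0) : G) = g ∧ (e (PresentedGroup.of 1) : G) = h

/-- The subgroup generated by `g` and `h` is free over the pair `(g, h)`. -/
def PairIsFree {G : Type*} [Group G] (g h : G) : Prop :=
  ∃ e : FreeGroup (Fin 2) ≃* Subgroup.closure ({g, h} : Set G),
    (e (FreeGroup.of 0) : G) = g ∧ (e (FreeGroup.of 1) : G) = h

/-! Pass to the Cayley graph with edges `y → y * g` and `y → y * h`. After inversion, `E` is a
vertex set whose boundary consists of just two edges, one labelled `g` and one labelled `h`, both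
pointing outwards.

If the pair is not free, a shortest nontrivial relation gives closed loops. A loop leaving `E`
through one boundary edge must come back through the other. Since short arcs are determined by their
values, the distance between such partner edges is the same for all shortest loops, and this forces
the signs in a loop to alternate (`IsLoop.alternating`). A shortest relation is then a power of `g *
h⁻¹`, up to conjugation and inversion, so this element has finite order
(`isOfFinOrder_of_not_injective`).

Finite order makes the two exit points differ by a power of `t = g * h⁻¹`, up to translation. An
uncrossing of translates of `E` then produces a set `X` that both walks leave only at 1
(`exists_leavesOnlyAt_one`). Now `U = h⁻¹ * g` preserves `X` while `Y = h` leaves it only at 1. A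
ping-pong argument (`injective_of_leavesOnlyAt`) shows that the only relations are those of the
cyclic group of `U`. -/

/-- A walk that starts in `S` and ends outside `S` has a step leaving `S`. -/
theorem exists_step_leaving {Γ : Type*} [Group Γ] (S : Set Γ) (l : List Γ) :
    ∀ q ∈ S, q * l.prod ∉ S →
      ∃ A s B, l = A ++ s :: B ∧ q * A.prod ∈ S ∧ q * A.prod * s ∉ S := by
  induction l with
  | nil => intro q hq h; simp at h; exact absurd hq h
  | cons s l ih =>
    intro q hq h
    by_cases hs : q * s ∈ S
    · obtain ⟨A, t, B, rfl, h1, h2⟩ := ih (q * s) hs (by simpa [mul_assoc] using h)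
      exact ⟨s :: A, t, B, rfl, by simpa [mul_assoc] using h1, by simpa [mul_assoc] using h2⟩
    · exact ⟨[], s, l, rfl, by simpa using hq, by simpa using hs⟩

/-- Right translation by `g` removes exactly the point `a` from `X`, in the sense that the walk
`y ↦ y * g` leaves `X` only from `a` and never enters `X`. -/
def LeavesOnlyAt {G : Type*} [Group G] (g : G) (X : Set G) (a : G) : Prop :=
  ∀ y, y * g ∈ X ↔ y ∈ X ∧ y ≠ a

/-! ### Ping-pong: a set preserved by one generator and left by the other at one point -/

section PingPong

variable {Γ G : Type*} [Group Γ] [Group G] {Φ : Γ →* G} {U Y : Γ} {X : Set G}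

theorem zpowers_invariant (hU : ∀ y, y * Φ U ∈ X ↔ y ∈ X) {s : Γ}
    (hs : s ∈ Subgroup.zpowers U) (y : G) : y * Φ s ∈ X ↔ y ∈ X := by
  have key : Subgroup.zpowers U ≤
      { carrier := {s | ∀ y, y * Φ s ∈ X ↔ y ∈ X}
        mul_mem' := fun {a b} ha hb y => by
          rw [map_mul, ← mul_assoc]; exact (hb _).trans (ha _)
        one_mem' := fun y => by simp
        inv_mem' := fun {a} ha y => by
          have := ha (y * Φ a⁻¹)
          simpa using this.symm : Subgroup Γ } :=
    Subgroup.zpowers_le.2 hU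
  exact key hs y

theorem eq_of_step_leaving (hY : LeavesOnlyAt (Φ Y) X 1)
    (hU : ∀ y, y * Φ U ∈ X ↔ y ∈ X) {s : Γ}
    (hs : s = Y ∨ s = Y⁻¹ ∨ s ∈ Subgroup.zpowers U) {q p : G}
    (hp : q⁻¹ * p ∈ X) (hps : q⁻¹ * (p * Φ s) ∉ X) : s = Y ∧ p = q := by
  rw [← mul_assoc] at hps
  rcases hs with rfl | rfl | hs
  · refine ⟨rfl, ?_⟩
    by_contra hne
    exact hps ((hY _).2 ⟨hp, fun h => hne (inv_mul_eq_one.1 h).symm⟩)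
  · refine absurd ((hY (q⁻¹ * p * Φ Y⁻¹)).1 (by simpa using hp)).1 hps
  · exact absurd ((zpowers_invariant hU hs _).2 hp) hps

/-- If an inverse letter `Y⁻¹` occurs in a trivial walk, it cancels against some letter `Y`. -/
theorem exists_cancelling_pair (h1 : (1 : G) ∈ X) (hY : LeavesOnlyAt (Φ Y) X 1)
    (hU : ∀ y, y * Φ U ∈ X ↔ y ∈ X) {A B : List Γ}
    (hl : ∀ s ∈ A ++ Y⁻¹ :: B, s = Y ∨ s = Y⁻¹ ∨ s ∈ Subgroup.zpowers U)
    (hΦ : Φ (A ++ Y⁻¹ :: B).prod = 1) :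
    ∃ (C M D : List Γ) (r : Γ), A ++ Y⁻¹ :: B = C ++ r :: (M ++ r⁻¹ :: D) ∧ Φ M.prod = 1 := by
  let q : Γ := A.prod * Y⁻¹
  let S : Set Γ := {x | (Φ q)⁻¹ * Φ x ∈ X}
  have hqS : q ∈ S := by simpa [S] using h1
  -- The step `Y⁻¹` enters `S` at `q`. As the walk is closed in `G`, it must also leave `S`, either
  -- within `A` or within `B`, and the only exit is a letter `Y` taken from the image of `q`.
  by_cases hend : q * B.prod ∈ S
  · have h1S : (1 : Γ) ∈ S := by
      have : Φ (q * B.prod) = 1 := by simpa [q, mul_assoc] using hΦ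
      simpa [S, this] using hend
    have hA : 1 * A.prod ∉ S := by
      intro h
      have h' : Φ Y ∈ X := by simpa [S, q] using h
      have := (hY 1).1 (by simpa using h')
      exact this.2 rfl
    obtain ⟨C, s, M, rfl, hC, hs⟩ := exists_step_leaving S A 1 h1S hA
    have hC' : (Φ q)⁻¹ * Φ C.prod ∈ X := by simpa [S] using hC
    have hs' : (Φ q)⁻¹ * (Φ C.prod * Φ s) ∉ X := by simpa [S] using hs
    obtain ⟨rfl, hq⟩ := eq_of_step_leaving hY hU (hl s (by simp)) hC' hs'
    refine ⟨C, M, B, s, by simp, ?_⟩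
    have : Φ C.prod = Φ C.prod * (Φ s * (Φ M.prod * (Φ s)⁻¹)) := by
      simpa [q, mul_assoc] using hq
    have h2 := (mul_eq_left.1 this.symm)
    have h3 : Φ s * Φ M.prod * (Φ s)⁻¹ = 1 := by simpa [mul_assoc] using h2
    simpa using (conj_eq_one_iff.1 h3)
  · obtain ⟨M, s, D, rfl, hM, hs⟩ := exists_step_leaving S B q hqS hend
    have hM' : (Φ q)⁻¹ * Φ (q * M.prod) ∈ X := hM
    have hs' : (Φ q)⁻¹ * (Φ (q * M.prod) * Φ s) ∉ X := by simpa [S, mul_assoc] using hs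
    obtain ⟨rfl, hq⟩ := eq_of_step_leaving hY hU (hl s (by simp)) hM' hs'
    refine ⟨A, M, D, s⁻¹, by simp, ?_⟩
    simpa using hq

/-- A walk in the letters `Y`, `Y⁻¹` and powers of `U` that is trivial in `G` is trivial. -/
theorem prod_eq_one_of_map_prod_eq_one (h1 : (1 : G) ∈ X) (hY : LeavesOnlyAt (Φ Y) X 1)
    (hU : ∀ y, y * Φ U ∈ X ↔ y ∈ X) (hinj : ∀ s ∈ Subgroup.zpowers U, Φ s = 1 → s = 1) :
    ∀ (n : ℕ) (l : List Γ), l.length = n →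
      (∀ s ∈ l, s = Y ∨ s = Y⁻¹ ∨ s ∈ Subgroup.zpowers U) → Φ l.prod = 1 → l.prod = 1 := by
  intro n
  induction n using Nat.strong_induction_on with
  | _ n ih =>
  have main : ∀ l : List Γ, l.length = n →
      (∀ s ∈ l, s = Y ∨ s = Y⁻¹ ∨ s ∈ Subgroup.zpowers U) → Y⁻¹ ∈ l →
      Φ l.prod = 1 → l.prod = 1 := by
    intro l hn hl hmem hΦ
    obtain ⟨A, B, rfl⟩ := List.append_of_mem hmem
    obtain ⟨C, M, D, r, heq, hM⟩ := exists_cancelling_pair h1 hY hU hl hΦ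
    rw [heq] at hn hl hΦ ⊢
    simp only [List.length_append, List.length_cons] at hn
    have hM1 : M.prod = 1 := ih M.length (by omega) M rfl
      (fun s hs => hl s (by simp [hs])) hM
    have hred : (C ++ r :: (M ++ r⁻¹ :: D)).prod = (C ++ D).prod := by simp [hM1]
    rw [hred] at hΦ ⊢
    refine ih (C ++ D).length (by simp; omega) _ rfl (fun s hs => hl s ?_) hΦ
    rcases List.mem_append.1 hs with h | h <;> simp [h]
  intro l hn hl hΦ
  by_cases hmem : Y⁻¹ ∈ l
  · exact main l hn hl hmem hΦ
  by_cases hmem' : Y ∈ l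
  -- Inverting the word keeps its length and turns `Y` into `Y⁻¹`.
  · have h := main (l.map (·⁻¹)).reverse (by simpa using hn) ?_ (by simpa using hmem') ?_
    · rwa [← List.prod_inv_reverse, inv_eq_one] at h
    · intro s hs
      have hs' : s⁻¹ ∈ l := by simpa [inv_eq_iff_eq_inv] using hs
      rcases hl _ hs' with h | h | h
      · exact Or.inr (Or.inl (by rw [← h, inv_inv]))
      · exact Or.inl (inv_inj.1 h)
      · exact Or.inr (Or.inr (by simpa using h))
    · rw [← List.prod_inv_reverse, map_inv, hΦ, inv_one]
  · refine hinj _ (Subgroup.list_prod_mem _ fun s hs => ?_) hΦ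
    rcases hl s hs with rfl | rfl | h
    · exact absurd hs hmem'
    · exact absurd hs hmem
    · exact h

theorem injective_of_leavesOnlyAt (h1 : (1 : G) ∈ X) (hY : LeavesOnlyAt (Φ Y) X 1)
    (hU : ∀ y, y * Φ U ∈ X ↔ y ∈ X) (hinj : ∀ s ∈ Subgroup.zpowers U, Φ s = 1 → s = 1)
    (hgen : Subgroup.closure {U, Y} = ⊤) : Function.Injective Φ := by
  refine (injective_iff_map_eq_one Φ).2 fun x hx => ?_
  have hx' : x ∈ (Subgroup.closure {U, Y}).toSubmonoid := by rw [hgen]; trivial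
  rw [Subgroup.closure_toSubmonoid] at hx'
  obtain ⟨l, hl, rfl⟩ := Submonoid.exists_list_of_mem_closure hx'
  refine prod_eq_one_of_map_prod_eq_one h1 hY hU hinj _ l rfl (fun s hs => ?_) hx
  have hz := Subgroup.mem_zpowers U
  rcases hl s hs with h | h
  · rcases h with rfl | rfl
    · exact Or.inr (Or.inr hz)
    · exact Or.inl rfl
  · rcases Set.mem_inv.1 h with h | h
    · exact Or.inr (Or.inr (inv_mem_iff.1 (by rw [h]; exact hz)))
    · rw [Set.mem_singleton_iff, inv_eq_iff_eq_inv] at h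
      exact Or.inr (Or.inl h)

end PingPong

/-! ### From the common exit point to the presentation -/

section Presentation

variable {G : Type*} [Group G] {g h : G}

theorem range_eq_closure_pair {Γ : Type*} [Group Γ] (Φ : Γ →* G) (x : Fin 2 → Γ)
    (hx : Subgroup.closure (Set.range x) = ⊤) (h0 : Φ (x 0) = g) (h1 : Φ (x 1) = h) :
    Φ.range = Subgroup.closure {g, h} := by
  rw [MonoidHom.range_eq_map, ← hx, MonoidHom.map_closure, ← Set.range_comp]
  congr 1
  ext y
  simp [Fin.exists_fin_two, h0, h1, eq_comm]

theorem exists_mulEquiv_closure_pair {Γ : Type*} [Group Γ] (Φ : Γ →* G)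
    (hΦ : Function.Injective Φ) (x : Fin 2 → Γ)
    (hx : Subgroup.closure (Set.range x) = ⊤) (h0 : Φ (x 0) = g) (h1 : Φ (x 1) = h) :
    ∃ e : Γ ≃* Subgroup.closure ({g, h} : Set G), (e (x 0) : G) = g ∧ (e (x 1) : G) = h :=
  ⟨(MonoidHom.ofInjective hΦ).trans
    (MulEquiv.subgroupCongr (range_eq_closure_pair Φ x hx h0 h1)), h0, h1⟩

theorem pairIsFree_of_injective (hinj : Function.Injective (FreeGroup.lift ![g, h])) :
    PairIsFree g h :=
  exists_mulEquiv_closure_pair _ hinj FreeGroup.of (FreeGroup.closure_range_of _)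
    (by simp) (by simp)

/-- Because both walks leave `X` at the same point, `h⁻¹ * g` preserves `X`, so ping-pong applies.
Infinite order is covered too: `orderOf` is then 0 and the relator is trivial. -/
theorem pairHasPresentation_of_leavesOnlyAt {X : Set G} (h1 : (1 : G) ∈ X)
    (hg : LeavesOnlyAt g X 1) (hh : LeavesOnlyAt h X 1) :
    PairHasPresentation g h
      {((FreeGroup.of 1)⁻¹ * FreeGroup.of 0) ^ orderOf (h⁻¹ * g)} := by
  set rels : Set (FreeGroup (Fin 2)) :=
    {((FreeGroup.of 1)⁻¹ * FreeGroup.of 0) ^ orderOf (h⁻¹ * g)} with hrels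
  have hr : ∀ r ∈ rels, FreeGroup.lift ![g, h] r = 1 := by
    rintro r rfl
    simp [pow_orderOf_eq_one]
  let Φ := PresentedGroup.toGroup hr
  have h0 : Φ (PresentedGroup.of 0) = g := by simp [Φ, PresentedGroup.toGroup.of]
  have h1' : Φ (PresentedGroup.of 1) = h := by simp [Φ, PresentedGroup.toGroup.of]
  let U : PresentedGroup rels := (PresentedGroup.of 1)⁻¹ * PresentedGroup.of 0
  have hΦU : Φ U = h⁻¹ * g := by simp [U, h0, h1']
  have hUk : U ^ orderOf (h⁻¹ * g) = 1 :=
    PresentedGroup.one_of_mem (rels := rels) (Set.mem_singleton _)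
  have hclos : Subgroup.closure (Set.range (PresentedGroup.of (rels := rels))) = ⊤ :=
    PresentedGroup.closure_range_of rels
  refine exists_mulEquiv_closure_pair Φ ?_ PresentedGroup.of hclos h0 h1'
  refine injective_of_leavesOnlyAt (U := U) (Y := PresentedGroup.of 1) (X := X) h1
    (by rwa [h1']) (fun y => ?_) ?_ ?_
  · rw [hΦU, ← mul_assoc, hg, ← hh, inv_mul_cancel_right]
  · rintro _ ⟨i, rfl⟩ hs
    simp only [map_zpow, hΦU] at hs
    obtain ⟨j, rfl⟩ := orderOf_dvd_iff_zpow_eq_one.2 hs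
    simp [zpow_mul, hUk]
  · rw [← top_le_iff, ← hclos, Subgroup.closure_le]
    have hU : U ∈ Subgroup.closure {U, PresentedGroup.of 1} := Subgroup.subset_closure (by simp)
    have hY : PresentedGroup.of 1 ∈ Subgroup.closure {U, PresentedGroup.of 1} :=
      Subgroup.subset_closure (by simp)
    rintro _ ⟨i, rfl⟩
    fin_cases i
    · simpa [U] using mul_mem hY hU
    · exact hY

end Presentation

/-! ### Uncrossing: moving the two exits to the same point -/

section Uncrossing

variable {G : Type*} [Group G] {g h : G} {E : Set G}

theorem LeavesOnlyAt.translate {a : G} (hg : LeavesOnlyAt g E a) (x : G) :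
    LeavesOnlyAt g {y | x⁻¹ * y ∈ E} (x * a) := by
  intro y
  simp only [Set.mem_ofPred_eq, ← mul_assoc, hg (x⁻¹ * y), ne_eq, inv_mul_eq_iff_eq_mul]

/-- If the walk `y ↦ y * g` leaves `E` only at `a`, and `y ↦ y * h` only at `b`, then along the
cosets of `⟨g * h⁻¹⟩` membership in `E` changes only at `a` and `b`. -/
theorem mul_mem_iff_of_leavesOnlyAt {a b : G} (hg : LeavesOnlyAt g E a)
    (hh : LeavesOnlyAt h E b) (w : G) :
    (w * (g * h⁻¹) ∈ E ∧ w * (g * h⁻¹) ≠ b) ↔ (w ∈ E ∧ w ≠ a) := by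
  rw [← hg, ← hh]
  simp [mul_assoc]

/-- The powers of `g * h⁻¹` start in `E` at 1, leave it at once unless the first power is `b`, and
can re-enter it only at `b`. Finite order brings them back to 1. -/
theorem exists_pow_eq_of_isOfFinOrder {b : G} (h1 : (1 : G) ∈ E) (hg : LeavesOnlyAt g E 1)
    (hh : LeavesOnlyAt h E b) (ht : IsOfFinOrder (g * h⁻¹)) : ∃ m : ℕ, (g * h⁻¹) ^ m = b := by
  by_contra! hne
  have key : ∀ m : ℕ, (g * h⁻¹) ^ (m + 1) ∉ E := by
    intro m
    induction m with
    | zero =>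
      intro hmem
      exact ((mul_mem_iff_of_leavesOnlyAt hg hh 1).1
        ⟨by simpa using hmem, by simpa using hne 1⟩).2 rfl
    | succ m ih =>
      intro hmem
      exact ih ((mul_mem_iff_of_leavesOnlyAt hg hh _).1
        ⟨by rwa [← pow_succ], by rw [← pow_succ]; exact hne _⟩).1
  obtain ⟨n, hn, hpow⟩ := ht.exists_pow_eq_one
  obtain ⟨m, rfl⟩ := Nat.exists_eq_succ_of_ne_zero hn.ne'
  exact key m (hpow ▸ h1)

/-- If `b` commutes with `t = g * h⁻¹`, then suitable translates of `E` can be combined to a set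
which both walks leave at the same point. -/
theorem exists_leavesOnlyAt_same {b : G} (h1 : (1 : G) ∈ E) (hbE : b ∈ E) (hb : b ≠ 1)
    (hg : LeavesOnlyAt g E 1) (hh : LeavesOnlyAt h E b) (hcomm : Commute b (g * h⁻¹)) :
    ∃ (X : Set G) (v : G), v ∈ X ∧ LeavesOnlyAt g X v ∧ LeavesOnlyAt h X v := by
  set t := g * h⁻¹ with ht
  by_cases hbt : b = t
  -- Here the two exit edges end at the same vertex, `1 * g = b * h = g`. Adjoining `g` to `E`
  -- absorbs both, and the walks now leave from `g`.
  · have hgE : g ∉ E := fun hmem => ((hg 1).1 (by simpa using hmem)).2 rfl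
    refine ⟨insert g E, g, Set.mem_insert _ _, fun y => ?_, fun y => ?_⟩
    · have := hg y
      simp only [Set.mem_insert_iff, mul_eq_right]
      grind
    · have := hh y
      have h2 : y * h = g ↔ y = b := by rw [hbt, ht, eq_mul_inv_iff_mul_eq]
      simp only [Set.mem_insert_iff, h2]
      grind
  have key := mul_mem_iff_of_leavesOnlyAt hg hh
  rw [← ht] at key
  have hcomm' : b * t = t * b := hcomm
  have htE : t ∉ E := fun hmem => by
    have := key 1
    simp only [one_mul] at this
    exact (this.1 ⟨hmem, Ne.symm hbt⟩).2 rfl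
  have htinvE : t⁻¹ ∈ E := ((key t⁻¹).1 (by simp [h1, hb.symm])).1
  have hbtE : b * t ∈ E := ((key b).2 ⟨hbE, hb⟩).1
  have hbtinvE : b * t⁻¹ ∉ E := fun hmem => by
    have := (key (b * t⁻¹)).2 ⟨hmem, by simpa [mul_inv_eq_one] using hbt⟩
    simp at this
  -- `T` is the translate `tE`. Under the `g`-walk `E \ T` is invariant, while `T \ E` is left at
  -- `t` and entered from 1. Under the `h`-walk `T \ E` is invariant, while `E \ T` is left at `b`
  -- and entered from `b * t`.
  let T : Set G := {y | t⁻¹ * y ∈ E}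
  have hTg : LeavesOnlyAt g T t := by simpa using hg.translate t
  have hTh : LeavesOnlyAt h T (t * b) := hh.translate t
  have hTb : b ∉ T := by
    change t⁻¹ * b ∉ E
    rwa [← (hcomm.inv_right).eq]
  have hT1 : (1 : G) ∈ T := by simpa [T] using htinvE
  have hFg : ∀ y, y * g ∈ E \ T ↔ y ∈ E \ T := by
    intro y
    have := hg y
    have := hTg y
    simp only [Set.mem_sdiff]
    grind
  have hFh : ∀ y, y * h ∈ E \ T ↔ (y ∈ E \ T ∧ y ≠ b) ∨ y = b * t := by
    intro y
    have := hh y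
    have := hTh y
    have : b * t ≠ b := by
      intro h'
      rw [mul_eq_left] at h'
      exact htE (h' ▸ h1)
    simp only [Set.mem_sdiff]
    grind
  have hFg' : ∀ y, y * g ∈ T \ E ↔ (y ∈ T \ E ∧ y ≠ t) ∨ y = 1 := by
    intro y
    have := hg y
    have := hTg y
    have : t ≠ 1 := fun h' => htE (h' ▸ h1)
    simp only [Set.mem_sdiff]
    grind
  have hFh' : ∀ y, y * h ∈ T \ E ↔ y ∈ T \ E := by
    intro y
    have := hh y
    have := hTh y
    simp only [Set.mem_sdiff]
    grind
  -- This translation moves the `g`-exit of `T \ E` from `t` to `b`, the `h`-exit of `E \ T`. In `(E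
  -- \ T) ∩ F` the unwanted entries disappear, since `b * t ∉ F` and `b * t⁻¹ ∉ E \ T`.
  let F : Set G := {y | (b * t⁻¹)⁻¹ * y ∈ T \ E}
  have hbF : b ∈ F := by
    have : (b * t⁻¹)⁻¹ * b = t := by simp
    simp only [F, Set.mem_ofPred_eq, this]
    exact ⟨by simpa [T] using h1, htE⟩
  have hFbt : b * t ∉ F := by
    have : (b * t⁻¹)⁻¹ * (b * t) = t * t := by simp [mul_assoc]
    simp only [F, Set.mem_ofPred_eq, this]
    intro h'
    exact htE (by simpa [T] using h'.1)
  refine ⟨(E \ T) ∩ F, b, ⟨⟨hbE, hTb⟩, hbF⟩, fun y => ?_, fun y => ?_⟩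
  · have e1 : y * g ∈ F ↔ (y ∈ F ∧ y ≠ b) ∨ y = b * t⁻¹ := by
      simp only [F, Set.mem_ofPred_eq, ← mul_assoc]
      rw [hFg', inv_mul_eq_one, ne_eq, inv_mul_eq_iff_eq_mul]
      simp [eq_comm]
    rw [Set.mem_inter_iff, Set.mem_inter_iff, hFg, e1]
    have : b * t⁻¹ ∉ E \ T := fun h' => hbtinvE h'.1
    grind
  · have e1 : y * h ∈ F ↔ y ∈ F := by
      simp only [F, Set.mem_ofPred_eq, ← mul_assoc]
      rw [hFh']
    rw [Set.mem_inter_iff, Set.mem_inter_iff, hFh, e1]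
    grind

theorem exists_leavesOnlyAt_one {a b : G} (haE : a ∈ E) (hbE : b ∈ E) (hab : a ≠ b)
    (hg : LeavesOnlyAt g E a) (hh : LeavesOnlyAt h E b) (ht : IsOfFinOrder (g * h⁻¹)) :
    ∃ X : Set G, (1 : G) ∈ X ∧ LeavesOnlyAt g X 1 ∧ LeavesOnlyAt h X 1 := by
  have hg' : LeavesOnlyAt g {y | a⁻¹⁻¹ * y ∈ E} 1 := by simpa using hg.translate a⁻¹
  have hh' := hh.translate a⁻¹
  have h1 : (1 : G) ∈ {y | a⁻¹⁻¹ * y ∈ E} := by simpa using haE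
  obtain ⟨m, hm⟩ := exists_pow_eq_of_isOfFinOrder h1 hg' hh' ht
  obtain ⟨X, v, hv, hXg, hXh⟩ := exists_leavesOnlyAt_same h1 (by simpa using hbE)
    (by simpa [inv_mul_eq_one] using hab) hg' hh' (hm ▸ Commute.pow_self _ m)
  exact ⟨{y | v⁻¹⁻¹ * y ∈ X}, by simpa using hv, by simpa using hXg.translate v⁻¹,
    by simpa using hXh.translate v⁻¹⟩

end Uncrossing

/-! ### Shortest relations as periodic loops -/

theorem inv_conj_eq_one_iff {G : Type*} [Group G] (x y : G) : y⁻¹ * x * y = 1 ↔ x = 1 := by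
  simpa using conj_eq_one_iff (a := y⁻¹) (b := x)

section Loops

/-- The inverse of a letter of the free group. -/
def invLetter {α : Type*} (p : α × Bool) : α × Bool := (p.1, !p.2)

/-- The first `L` letters of the sequence `s`. -/
def firstLetters {α : Type*} (s : ℤ → α × Bool) (L : ℕ) : List (α × Bool) :=
  (List.range L).map fun k : ℕ => s k

/-- The sequence `s` read from position `i`. -/
def shiftSeq {α : Type*} (s : ℤ → α × Bool) (i : ℤ) : ℤ → α × Bool := fun k => s (k + i)

/-- The sequence `s` traversed backwards from position `0`. -/
def revSeq {α : Type*} (s : ℤ → α × Bool) : ℤ → α × Bool := fun k => invLetter (s (-1 - k))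

/-- No two consecutive letters of `s` cancel. -/
def ReducedSeq {α : Type*} (s : ℤ → α × Bool) : Prop := ∀ i, s (i + 1) ≠ invLetter (s i)

variable {α : Type*} {s s' : ℤ → α × Bool}

@[simp] theorem invLetter_invLetter (p : α × Bool) : invLetter (invLetter p) = p := by
  simp [invLetter]

theorem shiftSeq_revSeq (s : ℤ → α × Bool) (i : ℤ) :
    shiftSeq (revSeq s) i = revSeq (shiftSeq s (-i)) := by
  funext k
  simp only [shiftSeq, revSeq]
  congr 2
  ring

theorem shiftSeq_shiftSeq (s : ℤ → α × Bool) (i j : ℤ) :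
    shiftSeq (shiftSeq s i) j = shiftSeq s (i + j) := by
  funext k
  simp only [shiftSeq]
  congr 1
  ring

theorem shiftSeq_zero (s : ℤ → α × Bool) : shiftSeq s 0 = s := by
  funext k
  simp [shiftSeq]

theorem ReducedSeq.shift (hs : ReducedSeq s) (i : ℤ) : ReducedSeq (shiftSeq s i) := by
  intro k
  have := hs (k + i)
  rwa [add_right_comm] at this

theorem ReducedSeq.rev (hs : ReducedSeq s) : ReducedSeq (revSeq s) := by
  intro k h
  apply hs (-1 - (k + 1))
  simp only [revSeq, invLetter_invLetter] at h
  rw [h]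
  congr 1
  ring

@[simp] theorem length_firstLetters (s : ℤ → α × Bool) (L : ℕ) : (firstLetters s L).length = L := by
  simp [firstLetters]

theorem firstLetters_succ (s : ℤ → α × Bool) (L : ℕ) : firstLetters s (L + 1) = firstLetters s L ++ [s L] := by
  simp [firstLetters, List.range_succ]

theorem firstLetters_add (s : ℤ → α × Bool) (L M : ℕ) :
    firstLetters s (L + M) = firstLetters s L ++ firstLetters (shiftSeq s L) M := by
  induction M with
  | zero => simp [firstLetters]
  | succ M ih =>
    rw [← add_assoc, firstLetters_succ, firstLetters_succ, ih, List.append_assoc]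
    simp [shiftSeq, add_comm]

theorem firstLetters_revSeq_shiftSeq (s : ℤ → α × Bool) (L : ℕ) :
    firstLetters (revSeq (shiftSeq s L)) L = FreeGroup.invRev (firstLetters s L) := by
  apply List.ext_getElem
  · simp
  · intro k hk hk'
    simp only [length_firstLetters] at hk
    simp only [firstLetters, FreeGroup.invRev, revSeq, shiftSeq, invLetter, List.getElem_map,
      List.getElem_range, List.getElem_reverse, List.length_map, List.length_range]
    have : (-1 - (k : ℤ) + L) = ((L - 1 - k : ℕ) : ℤ) := by omega
    rw [this]

theorem ReducedSeq.isReduced_firstLetters (hs : ReducedSeq s) (L : ℕ) :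
    FreeGroup.IsReduced (firstLetters s L) := by
  rw [FreeGroup.IsReduced, List.isChain_iff_getElem]
  intro k hk h1
  simp only [firstLetters, List.getElem_map, List.getElem_range] at h1 ⊢
  by_contra h2
  apply hs k
  push_cast at h1 h2
  exact Prod.ext h1.symm (by simp only [invLetter]; grind)

variable {G : Type*} [Group G] (f : α → G)

/-- The value in `G` of the first `L` letters of `s`. -/
def segVal (s : ℤ → α × Bool) (L : ℕ) : G := FreeGroup.lift f (FreeGroup.mk (firstLetters s L))

@[simp] theorem segVal_zero (s : ℤ → α × Bool) : segVal f s 0 = 1 := by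
  simp [segVal, firstLetters]

theorem segVal_add (s : ℤ → α × Bool) (L M : ℕ) :
    segVal f s (L + M) = segVal f s L * segVal f (shiftSeq s L) M := by
  rw [segVal, firstLetters_add, ← FreeGroup.mul_mk, map_mul, segVal, segVal]

theorem segVal_succ (s : ℤ → α × Bool) (L : ℕ) :
    segVal f s (L + 1) = segVal f s L * FreeGroup.lift f (FreeGroup.mk [s L]) := by
  rw [segVal, firstLetters_succ, ← FreeGroup.mul_mk, map_mul, segVal]

theorem segVal_one (s : ℤ → α × Bool) :
    segVal f s 1 = FreeGroup.lift f (FreeGroup.mk [s 0]) := by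
  rw [segVal, firstLetters]
  simp

theorem segVal_revSeq_shiftSeq (s : ℤ → α × Bool) (L : ℕ) :
    segVal f (revSeq (shiftSeq s L)) L = (segVal f s L)⁻¹ := by
  rw [segVal, firstLetters_revSeq_shiftSeq, ← FreeGroup.inv_mk, map_inv, segVal]

/-- A closed loop of length `n`: an `n`-periodic reduced sequence all of whose firstLetterss of length
`n` are trivial in `G`. -/
structure IsLoop (n : ℕ) (s : ℤ → α × Bool) : Prop where
  periodic : ∀ i, s (i + n) = s i
  reduced : ReducedSeq s
  closed : ∀ i, segVal f (shiftSeq s i) n = 1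

variable {f} {n : ℕ}

theorem IsLoop.shift (hs : IsLoop f n s) (i : ℤ) : IsLoop f n (shiftSeq s i) where
  periodic k := by
    have := hs.periodic (k + i)
    rwa [add_right_comm] at this
  reduced := hs.reduced.shift i
  closed k := by
    have := hs.closed (k + i)
    rwa [shiftSeq_shiftSeq, add_comm]

theorem IsLoop.rev (hs : IsLoop f n s) : IsLoop f n (revSeq s) where
  periodic k := by
    simp only [revSeq]
    rw [← hs.periodic (-1 - (k + n))]
    congr 2
    ring
  reduced := hs.reduced.rev
  closed k := by
    have : shiftSeq (revSeq s) k = revSeq (shiftSeq (shiftSeq s (-k - n)) n) := by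
      rw [shiftSeq_revSeq, shiftSeq_shiftSeq]
      congr 2
      ring
    rw [this, segVal_revSeq_shiftSeq, hs.closed, inv_one]

theorem IsLoop.segVal_eq_one (hs : IsLoop f n s) : segVal f s n = 1 := by
  simpa [shiftSeq_zero] using hs.closed 0

/-- The two arcs of a loop between two of its points have the same value. -/
theorem IsLoop.segVal_rev (hs : IsLoop f n s) {L : ℕ} (hL : L ≤ n) :
    segVal f (revSeq s) (n - L) = segVal f s L := by
  obtain ⟨M, rfl⟩ := Nat.exists_eq_add_of_le hL
  have h1 := hs.segVal_eq_one
  rw [segVal_add, mul_eq_one_iff_eq_inv] at h1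
  have h2 : revSeq s = revSeq (shiftSeq (shiftSeq s L) M) := by
    rw [shiftSeq_shiftSeq]
    congr 1
    funext k
    have := hs.periodic k
    simp only [shiftSeq]
    rw [← this]
    push_cast
    rfl
  rw [Nat.add_sub_cancel_left, h1, h2, segVal_revSeq_shiftSeq]

theorem apply_eq_of_firstLetters_eq {L L' : ℕ} (h : firstLetters s L = firstLetters s' L') {k : ℕ} (hk : k < L) :
    s k = s' k := by
  have hLL : L = L' := by simpa using congrArg List.length h
  subst hLL
  have := List.map_inj_left.1 h k (by simpa using hk)
  exact this

variable [DecidableEq α]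

/-- Short firstLetterss are determined by their values. -/
theorem firstLetters_eq_of_segVal_eq
    (hn : ∀ w : FreeGroup α, w ≠ 1 → FreeGroup.lift f w = 1 → n ≤ w.norm)
    (hs : ReducedSeq s) (hs' : ReducedSeq s') {L L' : ℕ} (hL : L + L' < n)
    (hval : segVal f s L = segVal f s' L') : firstLetters s L = firstLetters s' L' := by
  have hmk : FreeGroup.mk (firstLetters s L) = FreeGroup.mk (firstLetters s' L') := by
    by_contra hne
    have h1 := hn (FreeGroup.mk (firstLetters s L) * (FreeGroup.mk (firstLetters s' L'))⁻¹)
      (by rwa [ne_eq, mul_inv_eq_one]) (by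
        rw [map_mul, map_inv, mul_inv_eq_one]; exact hval)
    have h2 := FreeGroup.norm_mul_le (FreeGroup.mk (firstLetters s L)) (FreeGroup.mk (firstLetters s' L'))⁻¹
    rw [FreeGroup.norm_inv_eq] at h2
    have h3 := FreeGroup.norm_mk_le (L₁ := firstLetters s L)
    have h4 := FreeGroup.norm_mk_le (L₁ := firstLetters s' L')
    rw [length_firstLetters] at h3 h4
    omega
  have := FreeGroup.reduce.sound hmk
  rwa [(hs.isReduced_firstLetters L).reduce_eq, (hs'.isReduced_firstLetters L').reduce_eq] at this

/-- A loop exists unless `f` is a free basis of the subgroup it generates. -/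
theorem exists_loop_of_not_injective (hinj : ¬ Function.Injective (FreeGroup.lift f)) :
    ∃ n, 0 < n ∧ (∀ w : FreeGroup α, w ≠ 1 → FreeGroup.lift f w = 1 → n ≤ w.norm) ∧
      ∃ s, IsLoop f n s := by
  classical
  have hex : ∃ n, ∃ w : FreeGroup α, w ≠ 1 ∧ FreeGroup.lift f w = 1 ∧ w.norm = n := by
    by_contra! hall
    exact hinj ((injective_iff_map_eq_one _).2 fun w hw =>
      by_contra fun hne => hall _ w hne hw rfl)
  obtain ⟨w, hw1, hwf, hwn⟩ := Nat.find_spec hex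
  set n := Nat.find hex with hn
  have hmin : ∀ w : FreeGroup α, w ≠ 1 → FreeGroup.lift f w = 1 → n ≤ w.norm :=
    fun w h1 h2 => Nat.find_min' hex ⟨w, h1, h2, rfl⟩
  have hn0 : 0 < n := by
    rw [← hwn, Nat.pos_iff_ne_zero, ne_eq, FreeGroup.norm_eq_zero]
    exact hw1
  refine ⟨n, hn0, hmin, ?_⟩
  have hlen : w.toWord.length = n := hwn
  have hpos : ∀ i : ℤ, (i % n).toNat < w.toWord.length := by
    intro i
    have h1 := Int.emod_nonneg i (b := n) (by omega)
    have h2 := Int.emod_lt_of_pos i (b := n) (by omega)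
    omega
  let s : ℤ → α × Bool := fun i => w.toWord[(i % n).toNat]'(hpos i)
  have hsk : ∀ (k : ℕ) (hk : k < w.toWord.length), s k = w.toWord[k] := by
    intro k hk
    have : ((k : ℤ) % n).toNat = k := by
      rw [Int.emod_eq_of_lt (by omega) (by omega)]; simp
    simp only [s, this]
  have hper : ∀ i, s (i + n) = s i := by
    intro i
    simp only [s, Int.add_emod_right]
  have hseg : firstLetters s n = w.toWord := by
    apply List.ext_getElem
    · simp [hlen]
    · intro k hk hk'
      simp only [firstLetters, List.getElem_map, List.getElem_range]
      exact hsk k hk'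
  have hstep : ∀ i, FreeGroup.mk [s i] * FreeGroup.mk (firstLetters (shiftSeq s (i + 1)) n) =
      FreeGroup.mk (firstLetters (shiftSeq s i) n) * FreeGroup.mk [s i] := by
    intro i
    have h1 := firstLetters_add (shiftSeq s i) 1 n
    have h2 := firstLetters_succ (shiftSeq s i) n
    rw [add_comm, h2, shiftSeq_shiftSeq] at h1
    have h3 : firstLetters (shiftSeq s i) 1 = [s i] := by simp [firstLetters, shiftSeq]
    have h4 : shiftSeq s i n = s i := by rw [shiftSeq, add_comm, hper]
    rw [h3, h4] at h1
    rw [FreeGroup.mul_mk, FreeGroup.mul_mk, h1]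
    rfl
  have hstep' : ∀ i, FreeGroup.mk (firstLetters (shiftSeq s (i + 1)) n) = (FreeGroup.mk [s i])⁻¹ *
      FreeGroup.mk (firstLetters (shiftSeq s i) n) * FreeGroup.mk [s i] := by
    intro i
    rw [mul_assoc, ← hstep, inv_mul_cancel_left]
  -- Cyclic rotations of `w` are conjugates of `w`, so all of them are nontrivial relations.
  have hker : ∀ i : ℤ, FreeGroup.mk (firstLetters (shiftSeq s i) n) ≠ 1 ∧
      segVal f (shiftSeq s i) n = 1 := by
    have hiff : ∀ i : ℤ, (FreeGroup.mk (firstLetters (shiftSeq s (i + 1)) n) ≠ 1 ∧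
        segVal f (shiftSeq s (i + 1)) n = 1) ↔
        (FreeGroup.mk (firstLetters (shiftSeq s i) n) ≠ 1 ∧ segVal f (shiftSeq s i) n = 1) := by
      intro i
      rw [segVal, segVal, hstep' i, map_mul, map_mul, map_inv, ne_eq, inv_conj_eq_one_iff,
        inv_conj_eq_one_iff]
    intro i
    induction i using Int.induction_on with
    | zero =>
      rw [shiftSeq_zero, segVal, hseg, FreeGroup.mk_toWord]
      exact ⟨hw1, hwf⟩
    | succ i ih => exact (hiff _).2 ih
    | pred i ih => exact (hiff _).1 (by simpa using ih)
  refine ⟨s, hper, fun i hi => ?_, fun i => (hker i).2⟩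
  -- A cancelling pair, rotated to the front, would leave a nontrivial relation of norm at most `n -
  -- 2`. For `n = 1` the two letters are the same one, which is not its own inverse.
  rcases Nat.lt_or_ge n 2 with hn2 | hn2
  · have hn1 : n = 1 := by omega
    have := hper i
    rw [hn1, Nat.cast_one, hi] at this
    simpa [invLetter] using congrArg Prod.snd this
  · obtain ⟨M, hM⟩ := Nat.exists_eq_add_of_le hn2
    have h1 := firstLetters_add (shiftSeq s i) 2 M
    have h2 : firstLetters (shiftSeq s i) 2 = [s i, invLetter (s i)] := by
      rw [← hi, add_comm]
      simp [firstLetters, shiftSeq, List.range_succ]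
    have h3 : FreeGroup.mk [s i, invLetter (s i)] = 1 := by
      have h4 : [s i, invLetter (s i)] = [s i] ++ FreeGroup.invRev [s i] := by
        simp [FreeGroup.invRev, invLetter]
      rw [h4, ← FreeGroup.mul_mk, ← FreeGroup.inv_mk, mul_inv_cancel]
    have h5 := hmin _ (hker i).1 (hker i).2
    rw [hM, h1, h2, ← FreeGroup.mul_mk, h3, one_mul] at h5
    have h6 := FreeGroup.norm_mk_le (L₁ := firstLetters (shiftSeq (shiftSeq s i) (2 : ℕ)) M)
    rw [length_firstLetters] at h6
    omega

end Loops

/-! ### Partner edges: where a loop leaves and re-enters the set -/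

section Partners

variable {G : Type*} [Group G] {f a : Fin 2 → G} {E : Set G} {n : ℕ} {s s' : ℤ → Fin 2 × Bool}

theorem Fin.eq_or_eq_one_sub (x z : Fin 2) : z = x ∨ z = 1 - x := by
  revert x z; decide

/-- A loop that starts by leaving `E` has to enter `E` again, through the other generator. -/
theorem IsLoop.exists_partner
    (hn : ∀ w : FreeGroup (Fin 2), w ≠ 1 → FreeGroup.lift f w = 1 → n ≤ w.norm)
    (haE : ∀ x, a x ∈ E) (hE : ∀ x, LeavesOnlyAt (f x) E (a x)) (hne : ∀ x, a x ≠ a (1 - x))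
    (hn0 : 0 < n) (hs : IsLoop f n s) {x : Fin 2} (h0 : s 0 = (x, true)) :
    ∃ L : ℕ, 2 ≤ L ∧ L < n ∧ s (L - 1) = (1 - x, false) ∧
      segVal f s L = (a x)⁻¹ * a (1 - x) := by
  have hstart : a x * segVal f s 1 ∉ E := by
    rw [segVal_one, h0]
    intro h
    exact ((hE x (a x)).1 (by simpa using h)).2 rfl
  have hend : a x * segVal f s n ∈ E := by simpa [hs.segVal_eq_one] using haE x
  obtain ⟨k, hk1, hkn, hk, hk'⟩ : ∃ k, 1 ≤ k ∧ k < n ∧ a x * segVal f s k ∉ E ∧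
      a x * segVal f s (k + 1) ∈ E := by
    by_contra! hall
    have : ∀ k, 1 ≤ k → k ≤ n → a x * segVal f s k ∉ E := by
      intro k hk
      induction k, hk using Nat.le_induction with
      | base => exact fun _ => hstart
      | succ k hk ih => exact fun hkn => hall k hk (by omega) (ih (by omega))
    exact this n hn0 le_rfl hend
  rw [segVal_succ, ← mul_assoc] at hk'
  rcases hp : s k with ⟨z, _ | _⟩
  · rw [hp] at hk'
    have hk2 : a x * segVal f s k * (f z)⁻¹ ∈ E := by simpa using hk'
    have hz : a x * segVal f s k * (f z)⁻¹ = a z := by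
      by_contra hcon
      exact hk (by simpa using (hE z _).2 ⟨hk2, hcon⟩)
    have hval : segVal f s (k + 1) = (a x)⁻¹ * a z := by
      rw [segVal_succ, hp, ← hz]
      simp [mul_assoc]
    -- Returning through the edge of departure would close the loop early, against minimality, or
    -- make its last letter cancel its first.
    rcases Fin.eq_or_eq_one_sub x z with rfl | rfl
    · rw [inv_mul_cancel] at hval
      rcases (show k + 1 < n ∨ k + 1 = n by omega) with hlt | heq
      · have := firstLetters_eq_of_segVal_eq hn hs.reduced hs.reduced (L := k + 1) (L' := 0)
          (by omega) (by simpa using hval)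
        simpa using congrArg List.length this
      · refine absurd ?_ (hs.reduced k)
        have := hs.periodic 0
        rw [← heq, zero_add, h0] at this
        push_cast at this
        rw [this, hp]
        rfl
    · refine ⟨k + 1, by omega, ?_, by simpa using hp, hval⟩
      by_contra hcon
      have : k + 1 = n := by omega
      rw [this, hs.segVal_eq_one] at hval
      exact hne x (inv_mul_eq_one.1 hval.symm)
  · rw [hp] at hk'
    exact absurd ((hE z _).1 (by simpa using hk')).1 hk

/-- Two loops starting with the same generator reach a common value at the same time. -/
theorem IsLoop.length_le_of_segVal_eq
    (hn : ∀ w : FreeGroup (Fin 2), w ≠ 1 → FreeGroup.lift f w = 1 → n ≤ w.norm)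
    (hs : IsLoop f n s) (hs' : IsLoop f n s') (h0 : s 0 = s' 0) {L L' : ℕ} (hL : 0 < L)
    (hL' : L' < n) (hval : segVal f s L = segVal f s' L') : L' ≤ L := by
  by_contra! hlt
  -- If `L < L'`, the complementary arc of `s'` has length `n - L'`, short enough to coincide with
  -- the arc of `s`. Then `s' (-1)` is inverse to `s' 0`.
  rw [← hs'.segVal_rev hL'.le] at hval
  have hseg := firstLetters_eq_of_segVal_eq hn hs.reduced hs'.rev.reduced (by omega) hval
  have h1 := apply_eq_of_firstLetters_eq hseg hL
  apply hs'.reduced (-1)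
  simpa [revSeq, h0] using h1

/-- Reading the arc backwards exchanges the roles of the two generators, which makes the partner
distance independent of `x`. -/
theorem IsLoop.exists_partner_rev (hs : IsLoop f n s) {x : Fin 2} {L : ℕ}
    (hp : s (L - 1) = (1 - x, false)) (hval : segVal f s L = (a x)⁻¹ * a (1 - x)) :
    ∃ s', IsLoop f n s' ∧ s' 0 = (1 - x, true) ∧
      segVal f s' L = (a (1 - x))⁻¹ * a (1 - (1 - x)) := by
  refine ⟨revSeq (shiftSeq s L), (hs.shift L).rev, ?_, ?_⟩
  · have : (-1 - 0 + L : ℤ) = L - 1 := by ring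
    rw [revSeq, shiftSeq, this, hp]
    rfl
  · rw [segVal_revSeq_shiftSeq, hval]
    simp

/-- The distance between a positive letter and its partner is the same for all loops. -/
theorem exists_partner_distance
    (hn : ∀ w : FreeGroup (Fin 2), w ≠ 1 → FreeGroup.lift f w = 1 → n ≤ w.norm)
    (haE : ∀ x, a x ∈ E) (hE : ∀ x, LeavesOnlyAt (f x) E (a x)) (hne : ∀ x, a x ≠ a (1 - x))
    (hn0 : 0 < n) :
    ∃ L : ℕ, ∀ (x : Fin 2) (s : ℤ → Fin 2 × Bool), IsLoop f n s → s 0 = (x, true) →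
      2 ≤ L ∧ L < n ∧ s (L - 1) = (1 - x, false) ∧ segVal f s L = (a x)⁻¹ * a (1 - x) := by
  by_cases hex : ∃ (x : Fin 2) (s : ℤ → Fin 2 × Bool), IsLoop f n s ∧ s 0 = (x, true)
  · obtain ⟨x, s, hs, h0⟩ := hex
    obtain ⟨L, hL2, hLn, hp, hval⟩ := hs.exists_partner hn haE hE hne hn0 h0
    obtain ⟨r, hr, hr0, hrval⟩ := hs.exists_partner_rev hp hval
    refine ⟨L, fun z s' hs' h0' => ?_⟩
    obtain ⟨L', hL2', hLn', hp', hval'⟩ := hs'.exists_partner hn haE hE hne hn0 h0'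
    suffices L' = L by subst this; exact ⟨hL2', hLn', hp', hval'⟩
    rcases Fin.eq_or_eq_one_sub x z with rfl | rfl
    · exact le_antisymm
        (hs.length_le_of_segVal_eq hn hs' (h0.trans h0'.symm) (by omega) hLn'
          (hval.trans hval'.symm))
        (hs'.length_le_of_segVal_eq hn hs (h0'.trans h0.symm) (by omega) hLn
          (hval'.trans hval.symm))
    · exact le_antisymm
        (hr.length_le_of_segVal_eq hn hs' (hr0.trans h0'.symm) (by omega) hLn'
          (hrval.trans hval'.symm))
        (hs'.length_le_of_segVal_eq hn hr (h0'.trans hr0.symm) (by omega) hLn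
          (hval'.trans hrval.symm))
  · exact ⟨0, fun x s hs h0 => absurd ⟨x, s, hs, h0⟩ hex⟩

end Partners

/-! ### Combinatorics of sign alternation -/

section Alternation

variable {s : ℤ → Fin 2 × Bool} {n : ℕ}

theorem periodic_mul {β : Type*} {u : ℤ → β} (hper : ∀ i, u (i + n) = u i) (i : ℤ) (m : ℕ) :
    u (i + m * n) = u i := by
  induction m with
  | zero => simp
  | succ m ih =>
    rw [← ih, ← hper (i + m * n)]
    congr 1
    push_cast
    ring

/-- In a periodic sequence, a property inherited by the next letter holds everywhere as soon as it
holds somewhere. -/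
theorem forall_of_step {β : Type*} {u : ℤ → β} (hn0 : 0 < n) (hper : ∀ i, u (i + n) = u i)
    {P : β → Prop} (hstep : ∀ i, P (u i) → P (u (i + 1))) {i : ℤ} (hi : P (u i)) (j : ℤ) :
    P (u j) := by
  have hfwd : ∀ k : ℕ, P (u (i + k)) := by
    intro k
    induction k with
    | zero => simpa using hi
    | succ k ih =>
      have := hstep _ ih
      rwa [add_assoc] at this
  rw [← periodic_mul hper j (i - j).toNat]
  have h1 : (i - j).toNat ≤ ((i - j).toNat : ℤ) * n :=
    le_mul_of_one_le_right (by positivity) (by exact_mod_cast hn0)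
  obtain ⟨k, hk⟩ := Int.eq_ofNat_of_zero_le (a := j + (i - j).toNat * n - i) (by omega)
  have : j + ((i - j).toNat : ℕ) * n = i + k := by omega
  rw [this]
  exact hfwd k

/-- If each positive letter determines its successor, and its inverse correspondingly its
predecessor, then the signs alternate. -/
theorem alternating_of_successor (hn0 : 0 < n) (hper : ∀ i, s (i + n) = s i)
    (hred : ReducedSeq s) (N : Fin 2 → Fin 2 × Bool)
    (hpos : ∀ i x, s i = (x, true) → s (i + 1) = N x)
    (hneg : ∀ i x, s i = (x, false) → s (i - 1) = invLetter (N x))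
    {x : Fin 2} (hx : ∃ i, s i = (x, true)) (hx' : ∃ i, s i = (1 - x, false)) (i : ℤ) :
    (s (i + 1)).2 = !(s i).2 := by
  obtain ⟨p, hp⟩ := hx
  obtain ⟨q, hq⟩ := hx'
  have hNx := hpos p x hp
  -- Any other value of `N x` produces a cancelling pair, a clash with `hneg` at `q`, or a set of
  -- positive letters closed under successor, which periodicity would spread to the negative letter
  -- at `q`.
  have hNx' : N x = (1 - x, false) := by
    rcases hN : N x with ⟨z, _ | _⟩
    · rcases Fin.eq_or_eq_one_sub x z with rfl | rfl
      · exact absurd (hNx.trans hN) (by have := hred p; rw [hp] at this; exact this)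
      · rfl
    · exfalso
      rcases Fin.eq_or_eq_one_sub x z with rfl | rfl
      · have := forall_of_step hn0 hper (P := fun l => l = (z, true))
          (fun i hi => (hpos i z hi).trans hN) hp q
        simp [hq] at this
      · rcases hM : N (1 - x) with ⟨w, _ | _⟩
        · rcases Fin.eq_or_eq_one_sub x w with rfl | rfl
          · have h1 := hneg q _ hq
            rw [hM] at h1
            have h2 := hpos (q - 1) w h1
            rw [sub_add_cancel, hq, hN] at h2
            simp at h2
          · have h1 := hpos (p + 1) _ (hNx.trans hN)
            have h2 := hred (p + 1)
            rw [hNx, hN] at h2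
            exact h2 (h1.trans hM)
        · have := forall_of_step hn0 hper (P := fun l => l.2 = true) (fun i hi => by
            rcases Fin.eq_or_eq_one_sub x (s i).1 with h | h
            · rw [hpos i x (Prod.ext h hi), hN]
            · rw [hpos i (1 - x) (Prod.ext h hi), hM]) (by rw [hp]) q
          simp [hq] at this
  have hM : N (1 - x) = (x, false) := by
    have h1 := hneg (p + 1) (1 - x) (hNx.trans hNx')
    rw [add_sub_cancel_right, hp] at h1
    rw [← invLetter_invLetter (N (1 - x)), ← h1]
    rfl
  have hNneg : ∀ z, (N z).2 = false := by
    intro z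
    rcases Fin.eq_or_eq_one_sub x z with rfl | rfl
    · rw [hNx']
    · rw [hM]
  rcases hi : s i with ⟨z, _ | _⟩
  · rcases hi' : s (i + 1) with ⟨w, _ | _⟩
    · have := hneg (i + 1) w hi'
      rw [add_sub_cancel_right, hi] at this
      have h2 := congrArg Prod.snd this
      simp [invLetter, hNneg] at h2
    · rfl
  · rw [hpos i z hi, hNneg]
    rfl

/-- If every positive letter is followed at distance `m - 1` by a negative one, and conversely,
in a sequence of period `2 * m`, then the signs alternate. -/
theorem alternating_of_antipodal {m : ℕ} (hper : ∀ i, s (i + 2 * m) = s i)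
    (hpos : ∀ i, (s i).2 = true → (s (i + (m - 1))).2 = false)
    (hneg : ∀ i, (s i).2 = false → (s (i - (m - 1))).2 = true) (i : ℤ) :
    (s (i + 1)).2 = !(s i).2 := by
  have hflip : ∀ i, (s (i + (m - 1))).2 = !(s i).2 := by
    intro i
    cases h : (s i).2
    · cases h' : (s (i + (m - 1))).2
      · have := hneg _ h'
        rw [add_sub_cancel_right, h] at this
        simp at this
      · rfl
    · exact hpos i h
  -- Two flips shift by `2 * m - 2`, which is `-2` modulo the period. Hence signs are 2-periodic,
  -- and `m - 1` must be odd.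
  have htwo : ∀ i, (s (i + 2)).2 = (s i).2 := by
    intro i
    have h1 := hflip (i + 2)
    have h2 := hflip (i + 2 + (m - 1))
    rw [h1, Bool.not_not] at h2
    rw [← h2, ← hper i]
    congr 2
    ring
  have heven : ∀ (k : ℕ) (i : ℤ), (s (i + 2 * k)).2 = (s i).2 := by
    intro k
    induction k with
    | zero => simp
    | succ k ih =>
      intro i
      rw [← ih i, ← htwo (i + 2 * k)]
      congr 2
      push_cast
      ring
  rcases Nat.even_or_odd' m with ⟨k, rfl | rfl⟩
  · have h1 := hflip (i + 2)
    rw [htwo] at h1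
    rw [← h1, ← heven k (i + 1)]
    congr 2
    push_cast
    ring
  · have h1 := hflip i
    have h2 := heven k i
    push_cast at h1
    rw [add_sub_cancel_right, h2] at h1
    simp at h1

end Alternation

/-! ### Alternation of shortest loops and finite order -/

section FiniteOrder

variable {G : Type*} [Group G] {f a : Fin 2 → G} {E : Set G} {n : ℕ} {s : ℤ → Fin 2 × Bool}

theorem exists_common_letter {e : ℤ}
    (huniq : ∀ (x : Fin 2) (s s' : ℤ → Fin 2 × Bool), IsLoop f n s → IsLoop f n s' →
      s 0 = (x, true) → s' 0 = (x, true) → s e = s' e) :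
    ∃ N : Fin 2 → Fin 2 × Bool, ∀ x s, IsLoop f n s → s 0 = (x, true) → s e = N x := by
  have (x : Fin 2) : ∃ p : Fin 2 × Bool, ∀ s, IsLoop f n s → s 0 = (x, true) → s e = p := by
    by_cases hex : ∃ s, IsLoop f n s ∧ s 0 = (x, true)
    · obtain ⟨s', hs', h0'⟩ := hex
      exact ⟨s' e, fun s hs h0 => huniq x s s' hs hs' h0 h0'⟩
    · exact ⟨(0, true), fun s hs h0 => absurd ⟨s, hs, h0⟩ hex⟩
  choose N hN using this
  exact ⟨N, hN⟩

theorem IsLoop.apply_add_of_pos {e : ℤ} {M : Fin 2 → Fin 2 × Bool}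
    (hM : ∀ x s, IsLoop f n s → s 0 = (x, true) → s e = M x)
    (hs : IsLoop f n s) {i : ℤ} {x : Fin 2} (hi : s i = (x, true)) : s (i + e) = M x := by
  have := hM x (shiftSeq s i) (hs.shift i) (by simpa [shiftSeq] using hi)
  rwa [shiftSeq, add_comm] at this

theorem IsLoop.apply_sub_of_neg {e : ℤ} {M : Fin 2 → Fin 2 × Bool}
    (hM : ∀ x s, IsLoop f n s → s 0 = (x, true) → s e = M x)
    (hs : IsLoop f n s) {i : ℤ} {x : Fin 2} (hi : s i = (x, false)) :
    s (i - e) = invLetter (M x) := by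
  have := hM x (revSeq (shiftSeq s (i + 1))) (hs.shift _).rev
    (by simp [shiftSeq, revSeq, hi, invLetter])
  rw [← this, revSeq, invLetter_invLetter, shiftSeq]
  congr 1
  ring

/-- The signs of the letters in a shortest loop alternate. -/
theorem IsLoop.alternating
    (hn : ∀ w : FreeGroup (Fin 2), w ≠ 1 → FreeGroup.lift f w = 1 → n ≤ w.norm)
    (haE : ∀ x, a x ∈ E) (hE : ∀ x, LeavesOnlyAt (f x) E (a x)) (hne : ∀ x, a x ≠ a (1 - x))
    (hn0 : 0 < n) (hs : IsLoop f n s) (i : ℤ) : (s (i + 1)).2 = !(s i).2 := by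
  obtain ⟨L, hL⟩ := exists_partner_distance hn haE hE hne hn0
  have hpos {i : ℤ} {x : Fin 2} (hi : s i = (x, true)) : s (i + (L - 1)) = (1 - x, false) :=
    hs.apply_add_of_pos (M := fun x => (1 - x, false)) (fun x s hs h0 => (hL x s hs h0).2.2.1) hi
  have hneg {i : ℤ} {x : Fin 2} (hi : s i = (x, false)) : s (i - (L - 1)) = (1 - x, true) :=
    hs.apply_sub_of_neg (M := fun x => (1 - x, false)) (fun x s hs h0 => (hL x s hs h0).2.2.1) hi
  obtain ⟨x, ⟨p, hp⟩, hx'⟩ : ∃ x, (∃ i, s i = (x, true)) ∧ ∃ i, s i = (1 - x, false) := by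
    rcases h0 : s 0 with ⟨x, _ | _⟩
    · exact ⟨1 - x, ⟨_, hneg h0⟩, 0, by simpa using h0⟩
    · exact ⟨x, ⟨0, h0⟩, _, hpos h0⟩
  have hbd := hL x (shiftSeq s p) (hs.shift p) (by simpa [shiftSeq] using hp)
  -- If `2 * L < n`, the arc to the partner is determined by its value, so a positive letter
  -- determines its successor. If `2 * L > n`, the complementary arc is, so it determines its
  -- predecessor.
  rcases lt_trichotomy (2 * L) n with hlt | heq | hgt
  · obtain ⟨N, hN⟩ := exists_common_letter (f := f) (n := n) (e := 1)
      fun z r r' hr hr' h0 h0' => by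
        have hseg := firstLetters_eq_of_segVal_eq hn hr.reduced hr'.reduced
          (L := L) (L' := L) (by omega)
          ((hL z r hr h0).2.2.2.trans (hL z r' hr' h0').2.2.2.symm)
        simpa using apply_eq_of_firstLetters_eq hseg (k := 1) (by omega)
    exact alternating_of_successor hn0 hs.periodic hs.reduced N
      (fun i z hi => hs.apply_add_of_pos hN hi) (fun i z hi => hs.apply_sub_of_neg hN hi)
      ⟨p, hp⟩ hx' i
  · refine alternating_of_antipodal (m := L) (fun i => ?_) (fun i hi => ?_) (fun i hi => ?_) i
    · have := hs.periodic i
      rw [← heq] at this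
      exact_mod_cast this
    · rw [hpos (x := (s i).1) (Prod.ext rfl hi)]
    · rw [hneg (x := (s i).1) (Prod.ext rfl hi)]
  · obtain ⟨N, hN⟩ := exists_common_letter (f := f) (n := n) (e := -1)
      fun z r r' hr hr' h0 h0' => by
        have hval := (hL z r hr h0).2.2.2.trans (hL z r' hr' h0').2.2.2.symm
        rw [← hr.segVal_rev (by omega), ← hr'.segVal_rev (by omega)] at hval
        have hseg := firstLetters_eq_of_segVal_eq hn hr.rev.reduced hr'.rev.reduced
          (by omega) hval
        have := apply_eq_of_firstLetters_eq hseg (k := 0) (by omega)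
        simpa [revSeq] using congrArg invLetter this
    obtain ⟨q, hq⟩ := hx'
    -- Only the indexing is reversed here; unlike in `revSeq`, letters are not inverted, so
    -- predecessors become successors.
    have := alternating_of_successor (s := fun k => s (-k)) hn0
      (fun i => by
        rw [← hs.periodic (-(i + n))]
        congr 1
        ring)
      (fun i h => hs.reduced (-(i + 1)) (by
        change s (-(i + 1)) = _ at h
        rw [h, invLetter_invLetter]
        congr 1
        ring)) N
      (fun i z hi => by
        rw [← hs.apply_add_of_pos hN hi]
        congr 1
        ring)
      (fun i z hi => by
        rw [← hs.apply_sub_of_neg hN hi]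
        congr 1
        ring)
      (x := x) ⟨-p, by simpa using hp⟩ ⟨-q, by simpa using hq⟩ (-(i + 1))
    simp only [neg_add_rev, neg_neg, neg_add_cancel_comm_assoc] at this
    rw [eq_comm, Bool.not_eq_eq_eq_not]
    convert this using 3

/-- A pair of generators that is not free and has a set left by each of them at a single point has
a quotient of finite order. -/
theorem isOfFinOrder_of_not_injective (haE : ∀ x, a x ∈ E)
    (hE : ∀ x, LeavesOnlyAt (f x) E (a x)) (hne : ∀ x, a x ≠ a (1 - x))
    (hinj : ¬ Function.Injective (FreeGroup.lift f)) : IsOfFinOrder (f 0 * (f 1)⁻¹) := by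
  obtain ⟨n, hn0, hn, s, hs⟩ := exists_loop_of_not_injective hinj
  have halt := hs.alternating hn haE hE hne hn0
  have hnext : ∀ i, s (i + 1) = (1 - (s i).1, !(s i).2) := by
    intro i
    refine Prod.ext ?_ (halt i)
    rcases Fin.eq_or_eq_one_sub (s i).1 (s (i + 1)).1 with h | h
    · exact absurd (Prod.ext (y := invLetter (s i)) h (halt i)) (hs.reduced i)
    · exact h
  have hshift : shiftSeq s 2 = s := by
    funext i
    have : s (i + 1 + 1) = s i := by rw [hnext, hnext]; simp
    rwa [add_assoc] at this
  have hpow : ∀ k : ℕ, segVal f s (2 * k) = segVal f s 2 ^ k := by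
    intro k
    induction k with
    | zero => simp
    | succ k ih =>
      have := segVal_add f s 2 (2 * k)
      rw [Nat.cast_ofNat, hshift, ih] at this
      rw [mul_add, mul_one, add_comm, this, pow_succ']
  have hfin : IsOfFinOrder (segVal f s 2) := by
    refine isOfFinOrder_iff_pow_eq_one.2 ⟨n, hn0, ?_⟩
    -- Going round the loop twice has length `2 * n`, so the parity of `n` plays no role.
    rw [← hpow, two_mul, segVal_add, hs.segVal_eq_one, hs.closed, mul_one]
  have hval : segVal f s 2 = FreeGroup.lift f (FreeGroup.mk [s 0]) *
      FreeGroup.lift f (FreeGroup.mk [s 1]) := by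
    rw [segVal_succ, segVal_one, Nat.cast_one]
  have h1 := hnext 0
  rw [zero_add] at h1
  rw [hval, h1] at hfin
  rcases h0 : s 0 with ⟨x, _ | _⟩ <;> rw [h0] at hfin <;> fin_cases x
  · have hfin' : IsOfFinOrder ((f 0)⁻¹ * f 1) := by simpa using hfin
    simpa [mul_assoc] using (MulAut.conj (f 0)).toMonoidHom.isOfFinOrder hfin'.inv
  · have hfin' : IsOfFinOrder ((f 1)⁻¹ * f 0) := by simpa using hfin
    simpa [mul_assoc] using (MulAut.conj (f 1)).toMonoidHom.isOfFinOrder hfin'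
  · simpa using hfin
  · have hfin' : IsOfFinOrder (f 1 * (f 0)⁻¹) := by simpa using hfin
    simpa using hfin'.inv

end FiniteOrder

/-- Inversion turns left translation into right multiplication, along which words are read as walks.
-/
theorem leavesOnlyAt_inv {G : Type*} [Group G] {g a : G} {E : Set G} (h : g • E = E \ {a}) :
    LeavesOnlyAt g E⁻¹ a⁻¹ := by
  intro y
  have hy : y⁻¹ ∈ g • E ↔ y⁻¹ ∈ E \ {a} := by rw [h]
  rw [Set.mem_smul_set_iff_inv_smul_mem] at hy
  simpa [inv_eq_iff_eq_inv] using hy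

theorem mainTheorem1 {G : Type*} [Group G] (g h : G) (E : Set G) (hE : IsWSSubset g h E) :
    PairIsFree g h ∨
      ∃ k : ℕ, 2 ≤ k ∧
        PairHasPresentation g h {((FreeGroup.of 1)⁻¹ * FreeGroup.of 0) ^ k} := by
  obtain ⟨a, ha, b, hb, hab, hga, hhb⟩ := hE
  by_cases hinj : Function.Injective (FreeGroup.lift ![g, h])
  · exact Or.inl (pairIsFree_of_injective hinj)
  right
  have hg := leavesOnlyAt_inv hga
  have hh := leavesOnlyAt_inv hhb
  have ht : IsOfFinOrder (g * h⁻¹) := by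
    have := isOfFinOrder_of_not_injective (f := ![g, h]) (a := ![a⁻¹, b⁻¹]) (E := E⁻¹)
      (by simp [Fin.forall_fin_two, ha, hb]) (by simp [Fin.forall_fin_two, hg, hh])
      (by simp [Fin.forall_fin_two, hab, hab.symm]) hinj
    simpa using this
  obtain ⟨X, h1, hXg, hXh⟩ := exists_leavesOnlyAt_one (by simpa using ha) (by simpa using hb)
    (by simpa using hab) hg hh ht
  refine ⟨orderOf (h⁻¹ * g), ?_, pairHasPresentation_of_leavesOnlyAt h1 hXg hXh⟩
  have hu : IsOfFinOrder (h⁻¹ * g) := by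
    simpa [mul_assoc] using (MulAut.conj h⁻¹).toMonoidHom.isOfFinOrder ht
  have hne : orderOf (h⁻¹ * g) ≠ 1 := by
    rw [ne_eq, orderOf_eq_one_iff, inv_mul_eq_one]
    rintro rfl
    have hmem : a ∈ E \ {b} := ⟨ha, hab⟩
    rw [← hhb, hga] at hmem
    exact hmem.2 rfl
  have := hu.orderOf_pos
  omega
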